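/- Let $k\ge 1$, let $\alpha\in\mathbb{R}$ be such that $\zeta=e^{2\pi i\alpha}$ is a primitive $k$-th root of unity, and write $\zeta^{x}:=e^{2\pi i\alpha x}$ for $x\in\mathbb{R}$, $q:=\zeta e^{-t}$ and $q^{1/8}:=\zeta^{1/8}e^{-t/8}$. Consider the "strange" sums $$H_9(t,\zeta):=-\frac14\sum_{n=0}^{\infty}\frac{(1-q)(1-q^2)\cdots(1-q^n)}{(1+q)(1+q^2)\cdots(1+q^n)},\qquad H_{10}(t,\zeta):=-2q^{1/8}\sum_{n=0}^{\infty}\frac{(1-q^2)(1-q^4)\cdots(1-q^{2n})}{(1-q)(1-q^3)\cdots(1-q^{2n+1})},$$ and the Dirichlet series $$L_1(s,\zeta):=\sum_{n=1}^{\infty}\frac{(-\zeta)^{n^2}}{n^s},\qquad L_2(s,\zeta):=\sum_{n=1}^{\infty}\left(\frac2n\right)^2\frac{\zeta^{n^2/8}}{n^s}\qquad(\operatorname{Re}s>1),$$ where $\left(\frac2n\right)$ is the Kronecker symbol, so that $\left(\frac2n\right)^2$ is $1$ for odd $n$ and $0$ for even $n$. (1) If $k$ is odd, then $L_1(s,\zeta)$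 extends to an entire function of $s$, and, as $t\searrow0$, as power series in $t$, $$H_9(t,\zeta)=\sum_{n=0}^{\infty}\frac{L_1(-2n-1,\zeta)(-t)^n}{n!}.$$ (2) If $k$ is even, then $L_2(s,\zeta)$ extends to an entire function of $s$, and, as $t\searrow0$, as power series in $t$, $$H_{10}(t,\zeta)=\sum_{n=0}^{\infty}\frac{L_2(-2n-1,\zeta)(-t)^n}{8^n\,n!}.$$ The values at $s=-2n-1$ are those of the entire continuations. The sums $H_9,H_{10}$ are not claimed to converge for $t>0$; an identity $\sum_n u_n(t)=\sum_m c_mt^m$ as above means both of the following. (a) If the $u_n$ are expanded as formal power series in $t$, then $\sum_n u_n$ converges $t$-adically in $\mathbb{C}[[t]]$ to $\sum_m c_mt^m$. (b) For every $N\ge0$ and all sufficiently large $M$ (depending on $N$), $\sum_{n<M}u_n(t)-\sum_{m<N}c_mt^m=O(t^N)$ as $t\searrow0$. -/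

import Mathlib

open Filter Topology Asymptotics
open scoped PowerSeries NumberTheorySymbols

noncomputable section

/-- The power `ζ ^ x` of the root of unity `ζ = exp (2 π i α)`, the branch being fixed by `α`:
`ζ ^ x = exp (2 π i α x)`. -/
def zetaPow (α x : ℝ) : ℂ :=
  Complex.exp (2 * Real.pi * Complex.I * α * x)

/-- `ζ e^{-t}` as a function of the real variable `t`. -/
def qFun (α t : ℝ) : ℂ := zetaPow α 1 * Complex.exp (-t)

/-- `(ζ e^{-t}) ^ (1/8)` as a function of the real variable `t`. -/
def qEighthFun (α t : ℝ) : ℂ := zetaPow α (1 / 8) * Complex.exp (-t / 8)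

/-- `ζ e^{-t}` as a formal power series in `t`. -/
def qSer (α : ℝ) : ℂ⟦X⟧ :=
  PowerSeries.C (zetaPow α 1) * PowerSeries.rescale (-1 : ℂ) (PowerSeries.exp ℂ)

/-- `(ζ e^{-t}) ^ (1/8)` as a formal power series in `t`. -/
def qEighthSer (α : ℝ) : ℂ⟦X⟧ :=
  PowerSeries.C (zetaPow α (1 / 8)) * PowerSeries.rescale (-1 / 8 : ℂ) (PowerSeries.exp ℂ)

/-- `(q; q)_n / (-q; q)_n`, used both for complex numbers and for formal power series. -/
def strange9 {R : Type} [CommRing R] [Inv R] (q : R) (n : ℕ) : R :=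
  (∏ j ∈ Finset.range n, (1 - q ^ (j + 1))) * (∏ j ∈ Finset.range n, (1 + q ^ (j + 1)))⁻¹

/-- `r * (q²; q²)_n / (q; q²)_{n+1}`, where `r` stands for `q ^ (1/8)`; used both for complex
numbers and for formal power series. -/
def strange10 {R : Type} [CommRing R] [Inv R] (r q : R) (n : ℕ) : R :=
  r * (∏ j ∈ Finset.range n, (1 - q ^ (2 * (j + 1)))) *
    (∏ j ∈ Finset.range (n + 1), (1 - q ^ (2 * j + 1)))⁻¹

/-- The `n`-th summand of the strange sum `H₉(t, ζ)`, as a function of `t`. -/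
def H9Fun (α : ℝ) (n : ℕ) (t : ℝ) : ℂ := -(1 / 4) * strange9 (qFun α t) n

/-- The `n`-th summand of the strange sum `H₉(t, ζ)`, as a formal power series in `t`. -/
def H9Ser (α : ℝ) (n : ℕ) : ℂ⟦X⟧ := PowerSeries.C (-(1 / 4)) * strange9 (qSer α) n

/-- The `n`-th summand of the strange sum `H₁₀(t, ζ)`, as a function of `t`. -/
def H10Fun (α : ℝ) (n : ℕ) (t : ℝ) : ℂ := -2 * strange10 (qEighthFun α t) (qFun α t) n

/-- The `n`-th summand of the strange sum `H₁₀(t, ζ)`, as a formal power series in `t`. -/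
def H10Ser (α : ℝ) (n : ℕ) : ℂ⟦X⟧ :=
  PowerSeries.C (-2) * strange10 (qEighthSer α) (qSer α) n

/-- The series `∑ u n` of formal power series converges `t`-adically to `∑ c m t ^ m`: each
coefficient of the partial sums is eventually constant, equal to that of the limit. -/
def IsFormalSum (u : ℕ → ℂ⟦X⟧) (c : ℕ → ℂ) : Prop :=
  ∀ m : ℕ, ∀ᶠ M in atTop, PowerSeries.coeff m (∑ n ∈ Finset.range M, u n) = c m

/-- The strange sum `∑ u n t` has the asymptotic power series `∑ c m t ^ m` as `t ↘ 0`. The sum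
need not converge for any `t > 0`; the meaning is that, for each order `N`, all sufficiently long
partial sums agree with the power series up to an error `O(t ^ N)`. -/
def HasStrangeAsymptotics (u : ℕ → ℝ → ℂ) (c : ℕ → ℂ) : Prop :=
  ∀ N : ℕ, ∀ᶠ M in atTop,
    (fun t : ℝ => ∑ n ∈ Finset.range M, u n t - ∑ m ∈ Finset.range N, c m * (t : ℂ) ^ m)
      =O[𝓝[>] (0 : ℝ)] fun t : ℝ => t ^ N

/-- Coefficients of the Dirichlet series `L₁(s, ζ) = ∑_{n ≥ 1} (-ζ) ^ (n²) / n ^ s`. -/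
def coeffL1 (α : ℝ) (n : ℕ) : ℂ := (-zetaPow α 1) ^ (n ^ 2)

/-- Coefficients of the Dirichlet series `L₂(s, ζ) = ∑_{n ≥ 1} (2/n)² ζ ^ (n²/8) / n ^ s`. -/
def coeffL2 (α : ℝ) (n : ℕ) : ℂ := (J(2 | n) : ℂ) ^ 2 * zetaPow α ((n : ℝ) ^ 2 / 8)

/-- `L` is the (necessarily unique) entire continuation of the Dirichlet series
`∑_{n ≥ 1} a n / n ^ s`, which converges for `Re s > 1`. -/
def IsEntireContinuation (a : ℕ → ℂ) (L : ℂ → ℂ) : Prop :=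
  Differentiable ℂ L ∧ ∀ s : ℂ, 1 < s.re → LSeriesHasSum a s (L s)

end

/-!
Deform the strange sum by a variable `x = q ^ w`, where `q = ζ e ^ (-t)` and `w` is an
indeterminate. The Rogers–Fine functional equation relates the deformed sums at `x` and at `x q`
(or `x q²`). Multiplied by a suitable theta term and iterated, it telescopes: modulo any power of
`t`, a long partial sum `V(w)` satisfies
`V(w) - V(w + N) = b ∑_{n < N} a n * e ^ (-c (n + w)² t)`,
where `a` is the sequence of coefficients of the Dirichlet series and `N` is a period of it.

The coefficients of `V` in `t` are polynomials in `w`, so this difference equation determines them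
up to constants: they are sums of Bernoulli polynomials. Hence their derivatives at `w = 0` are,
up to explicit factors, the values of the continued Dirichlet series at negative odd integers. On
the other hand `V` contains the factor `1 - x`, which vanishes at `w = 0`, so its derivative at
`w = 0` is a multiple of `t` times the strange sum itself.
-/

open scoped Polynomial Ring

section DirichletSeries

theorem sum_range_two_mul_eq_zero_of_antiperiodic {A : Type*} [AddCommGroup A] {a : ℕ → A} {K : ℕ}
    (ha : Function.Antiperiodic a K) : ∑ n ∈ Finset.range (2 * K), a n = 0 := by
  rw [two_mul, Finset.sum_range_add, ← Finset.sum_add_distrib]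
  refine Finset.sum_eq_zero fun n _ => ?_
  rw [add_comm K n, ha n, add_neg_cancel]

theorem sum_zmod_val {A : Type*} [AddCommMonoid A] (N : ℕ) [NeZero N] (f : ℕ → A) :
    ∑ j : ZMod N, f j.val = ∑ n ∈ Finset.range N, f n := by
  refine Finset.sum_bij (fun j _ => j.val) (fun j _ => Finset.mem_range.2 (ZMod.val_lt j))
    (fun i _ j _ h => ZMod.val_injective N h) (fun n hn => ?_) (fun _ _ => rfl)
  exact ⟨n, Finset.mem_univ _, ZMod.val_cast_of_lt (Finset.mem_range.1 hn)⟩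

theorem IsEntireContinuation.unique {a : ℕ → ℂ} {L L' : ℂ → ℂ} (h : IsEntireContinuation a L)
    (h' : IsEntireContinuation a L') : L = L' := by
  have hL : AnalyticOnNhd ℂ L Set.univ := fun z _ => h.1.analyticAt z
  have hL' : AnalyticOnNhd ℂ L' Set.univ := fun z _ => h'.1.analyticAt z
  have hopen : IsOpen {s : ℂ | 1 < s.re} := isOpen_lt continuous_const Complex.continuous_re
  refine hL.eq_of_eventuallyEq hL' (z₀ := 2) ?_
  filter_upwards [hopen.mem_nhds (show (2 : ℂ) ∈ {s : ℂ | 1 < s.re} by simp)] with s hs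
  exact (h.2 s hs).LSeries_eq.symm.trans (h'.2 s hs).LSeries_eq

variable {a : ℕ → ℂ} {N : ℕ} [NeZero N]

theorem isEntireContinuation_LFunction (ha : Function.Periodic a N)
    (h0 : ∑ n ∈ Finset.range N, a n = 0) :
    IsEntireContinuation a (ZMod.LFunction fun j : ZMod N => a j.val) := by
  refine ⟨ZMod.differentiable_LFunction_of_sum_zero (by rw [sum_zmod_val N a, h0]), fun s hs => ?_⟩
  have hval : (fun n : ℕ => a (n : ZMod N).val) = a :=
    funext fun n => by rw [ZMod.val_natCast, ha.map_mod_nat]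
  have h := ZMod.LSeriesSummable_of_one_lt_re (fun j : ZMod N => a j.val) hs
  rw [ZMod.LFunction_eq_LSeries _ hs]
  rw [hval] at h ⊢
  exact h.LSeriesHasSum

/-- The polynomial `-N ^ m / (m + 1) * ∑_{n < N} a n * B_{m + 1}((w + n) / N)` in `w`: for `a` of
period `N` it is the regularized value of `∑_{n ≥ 0} a n * (n + w) ^ m`, with `B` the Bernoulli
polynomials. -/
noncomputable def bernoulliSum (a : ℕ → ℂ) (N m : ℕ) : ℂ[X] :=
  ∑ n ∈ Finset.range N, Polynomial.C (a n * (-(N : ℂ) ^ m / (m + 1))) *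
    ((Polynomial.bernoulli (m + 1)).map (algebraMap ℚ ℂ)).comp
      (Polynomial.C (N : ℂ)⁻¹ * (Polynomial.X + Polynomial.C (n : ℂ)))

theorem eval_bernoulliSum (a : ℕ → ℂ) (N m : ℕ) (w : ℂ) :
    (bernoulliSum a N m).eval w = ∑ n ∈ Finset.range N, a n * (-(N : ℂ) ^ m / (m + 1)) *
      ((Polynomial.bernoulli (m + 1)).map (algebraMap ℚ ℂ)).eval ((w + n) / N) := by
  rw [bernoulliSum, Polynomial.eval_finsetSum]
  refine Finset.sum_congr rfl fun n _ => ?_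
  simp only [Polynomial.eval_mul, Polynomial.eval_C, Polynomial.eval_comp, Polynomial.eval_add,
    Polynomial.eval_X, div_eq_inv_mul (w + n)]

theorem bernoulli_map_eval_add_one (m : ℕ) (x : ℂ) :
    ((Polynomial.bernoulli (m + 1)).map (algebraMap ℚ ℂ)).eval (x + 1) =
      ((Polynomial.bernoulli (m + 1)).map (algebraMap ℚ ℂ)).eval x + (m + 1) * x ^ m := by
  have h := congrArg (fun p => (p.map (algebraMap ℚ ℂ)).eval x)
    (Polynomial.bernoulli_comp_one_add_X (m + 1))
  simpa [Polynomial.map_comp, add_comm x] using h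

theorem bernoulliSum_eval_sub_eval_add (a : ℕ → ℂ) (N : ℕ) [NeZero N] (m : ℕ) (w : ℂ) :
    (bernoulliSum a N m).eval w - (bernoulliSum a N m).eval (w + N) =
      ∑ n ∈ Finset.range N, a n * (n + w) ^ m := by
  have hN : (N : ℂ) ≠ 0 := NeZero.ne _
  have hm : (m + 1 : ℂ) ≠ 0 := by exact_mod_cast m.succ_ne_zero
  rw [eval_bernoulliSum, eval_bernoulliSum, ← Finset.sum_sub_distrib]
  refine Finset.sum_congr rfl fun n _ => ?_
  rw [show (w + N + n) / N = (w + n) / N + 1 by field_simp; ring, bernoulli_map_eval_add_one,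
    div_pow, add_comm (n : ℂ)]
  field_simp
  ring

theorem derivative_bernoulliSum (a : ℕ → ℂ) (N : ℕ) [NeZero N] (m : ℕ) :
    Polynomial.derivative (bernoulliSum a N (m + 1)) =
      Polynomial.C (m + 1 : ℂ) * bernoulliSum a N m := by
  have hN : (N : ℂ) ≠ 0 := NeZero.ne _
  have hm : (m + 1 : ℂ) ≠ 0 := by exact_mod_cast m.succ_ne_zero
  have hm' : (m + 1 + 1 : ℂ) ≠ 0 := by exact_mod_cast (m + 1).succ_ne_zero
  rw [bernoulliSum, bernoulliSum, Polynomial.derivative_sum, Finset.mul_sum]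
  refine Finset.sum_congr rfl fun n _ => Polynomial.funext fun w => ?_
  rw [Polynomial.derivative_C_mul, Polynomial.derivative_comp, Polynomial.derivative_map,
    Polynomial.derivative_bernoulli_add_one]
  simp only [Polynomial.derivative_mul, Polynomial.derivative_add, Polynomial.derivative_X,
    Polynomial.derivative_C, Polynomial.eval_mul, Polynomial.eval_C, Polynomial.eval_comp,
    Polynomial.eval_add, Polynomial.eval_X, Polynomial.map_mul, Polynomial.map_natCast,
    Polynomial.map_add, Polynomial.map_one, Polynomial.eval_natCast, Polynomial.eval_one,
    Polynomial.eval_zero]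
  push_cast
  field_simp
  ring

theorem LFunction_neg_natCast (a : ℕ → ℂ) (N : ℕ) [NeZero N] {m : ℕ} (hm : m ≠ 0) :
    ZMod.LFunction (fun j : ZMod N => a j.val) (-m) = (bernoulliSum a N m).eval 0 := by
  rw [ZMod.LFunction, neg_neg, Complex.cpow_natCast, eval_bernoulliSum, ← sum_zmod_val N,
    Finset.mul_sum]
  refine Finset.sum_congr rfl fun j _ => ?_
  have hx : (j.val / N : ℝ) ∈ Set.Icc (0 : ℝ) 1 := ⟨by positivity,
    (div_le_one (Nat.cast_pos.2 (NeZero.pos N))).2 (Nat.cast_le.2 (ZMod.val_lt j).le)⟩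
  rw [ZMod.toAddCircle_apply, HurwitzZeta.hurwitzZeta_neg_nat hm hx, zero_add]
  push_cast
  ring

theorem derivative_eq_zero_of_eval_add_eq {p : ℂ[X]} {c : ℂ} (hc : c ≠ 0)
    (hp : ∀ w, p.eval (w + c) = p.eval w) : Polynomial.derivative p = 0 := by
  have hper : ∀ j : ℕ, p.eval (j * c) = p.eval 0 := fun j => by
    induction j with
    | zero => simp
    | succ j ih => rw [Nat.cast_succ, add_one_mul, hp, ih]
  have hinj : Function.Injective fun j : ℕ => (j : ℂ) * c := fun i j hij =>
    Nat.cast_injective (mul_right_cancel₀ hc hij)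
  have hconst : p = Polynomial.C (p.eval 0) := by
    refine Polynomial.eq_of_infinite_eval_eq _ _ ((Set.infinite_range_of_injective hinj).mono ?_)
    rintro _ ⟨j, rfl⟩
    exact (hper j).trans Polynomial.eval_C.symm
  rw [hconst, Polynomial.derivative_C]

theorem IsEntireContinuation.derivative_eval_zero_eq {L : ℂ → ℂ} (hL : IsEntireContinuation a L)
    (ha : Function.Periodic a N) (h0 : ∑ n ∈ Finset.range N, a n = 0) {m : ℕ} (hm : m ≠ 0) {c : ℂ}
    {p : ℂ[X]} (hp : ∀ w, p.eval w - p.eval (w + N) =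
      c * ∑ n ∈ Finset.range N, a n * (n + w) ^ (m + 1)) :
    (Polynomial.derivative p).eval 0 = c * ((m + 1) * L (-m)) := by
  have hd : Polynomial.derivative (p - Polynomial.C c * bernoulliSum a N (m + 1)) = 0 := by
    refine derivative_eq_zero_of_eval_add_eq (NeZero.ne (N : ℂ)) fun w => ?_
    simp only [Polynomial.eval_sub, Polynomial.eval_mul, Polynomial.eval_C]
    linear_combination c * bernoulliSum_eval_sub_eval_add a N (m + 1) w - hp w
  rw [Polynomial.derivative_sub, Polynomial.derivative_C_mul, derivative_bernoulliSum,
    sub_eq_zero] at hd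
  rw [hd, hL.unique (isEntireContinuation_LFunction ha h0), LFunction_neg_natCast a N hm]
  simp only [Polynomial.eval_mul, Polynomial.eval_C]

end DirichletSeries

section ExpSeries

variable {A B : Type*} [CommRing A] [Algebra ℚ A] [CommRing B] [Algebra ℚ B]

/-- The formal power series `e ^ (a t)` in `t`. -/
noncomputable def expSeries (a : A) : A⟦X⟧ := PowerSeries.rescale a (PowerSeries.exp A)

theorem coeff_expSeries (a : A) (n : ℕ) :
    PowerSeries.coeff n (expSeries a) = a ^ n * algebraMap ℚ A (1 / n.factorial) := by
  rw [expSeries, PowerSeries.coeff_rescale, PowerSeries.coeff_exp]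

theorem constantCoeff_expSeries (a : A) : PowerSeries.constantCoeff (expSeries a) = 1 := by
  rw [← PowerSeries.coeff_zero_eq_constantCoeff_apply, coeff_expSeries]
  simp

theorem expSeries_zero : expSeries (0 : A) = 1 := by
  simp [expSeries]

theorem expSeries_add (a b : A) : expSeries (a + b) = expSeries a * expSeries b :=
  (PowerSeries.exp_mul_exp_eq_exp_add a b).symm

theorem map_expSeries (f : A →+* B) (a : A) :
    PowerSeries.map f (expSeries a) = expSeries (f a) := by
  rw [expSeries, expSeries, ← PowerSeries.rescale_map, PowerSeries.map_exp]

/-- The formal power series `q ^ (i + p)` in `t`, where `q = z e ^ (-t)` and `z ^ (i + p)` is read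
as `z ^ i`: the shift `p` of the exponent only affects the exponential. -/
noncomputable def qPow (z : A) (i : ℕ) (p : A) : A⟦X⟧ :=
  PowerSeries.C (z ^ i) * expSeries (-(i + p))

theorem qPow_mul_qPow (z : A) (i j : ℕ) (p r : A) :
    qPow z i p * qPow z j r = qPow z (i + j) (p + r) := by
  rw [qPow, qPow, qPow, mul_mul_mul_comm, ← map_mul, ← pow_add, ← expSeries_add]
  congr 2
  push_cast
  ring

theorem qPow_zero (z p : A) : qPow z 0 p = expSeries (-p) := by
  simp [qPow]

theorem qPow_zero_zero (z : A) : qPow z 0 0 = 1 := by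
  rw [qPow_zero, neg_zero, expSeries_zero]

theorem qPow_pow (z : A) (i : ℕ) (p : A) (n : ℕ) : qPow z i p ^ n = qPow z (i * n) (n * p) := by
  induction n with
  | zero => simp [qPow_zero_zero]
  | succ n ih =>
    rw [pow_succ, ih, qPow_mul_qPow, Nat.cast_succ, add_one_mul, mul_add_one]

theorem qPow_add_period {z : A} {k : ℕ} (hz : z ^ k = 1) (i : ℕ) (p : A) :
    qPow z (i + k) p = qPow z i (p + k) := by
  rw [qPow, qPow, pow_add, hz, mul_one]
  congr 2
  push_cast
  ring

theorem qPow_neg {j : ℕ} (hj : Odd j) (z p : A) : qPow (-z) j p = -qPow z j p := by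
  rw [qPow, qPow, hj.neg_pow, map_neg, neg_mul]

theorem constantCoeff_qPow (z : A) (i : ℕ) (p : A) :
    PowerSeries.constantCoeff (qPow z i p) = z ^ i := by
  rw [qPow, map_mul, PowerSeries.constantCoeff_C, constantCoeff_expSeries, mul_one]

theorem map_qPow (f : A →+* B) (z : A) (i : ℕ) (p : A) :
    PowerSeries.map f (qPow z i p) = qPow (f z) i (f p) := by
  rw [qPow, map_mul, PowerSeries.map_C, map_expSeries, qPow]
  simp

/-- The summand `a n * e ^ (-c (n + w) ^ 2 t)` of a partial theta series, as a power series
in `t`. -/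
noncomputable def thetaTerm (a : ℕ → A) (c w : A) (n : ℕ) : A⟦X⟧ :=
  PowerSeries.C (a n) * expSeries (-c * (n + w) ^ 2)

theorem thetaTerm_mul_qPow {a : ℕ → A} {c w p z : A} {n m j : ℕ} (ha : a m = a n * z ^ j)
    (hexp : c * (m + w) ^ 2 = c * (n + w) ^ 2 + (j + p)) :
    thetaTerm a c w n * qPow z j p = thetaTerm a c w m := by
  rw [thetaTerm, thetaTerm, qPow, mul_mul_mul_comm, ← map_mul, ← expSeries_add, ha]
  congr 2
  linear_combination hexp

theorem thetaTerm_add_period {a : ℕ → A} {N : ℕ} (ha : Function.Periodic a N) (c w : A) (n : ℕ) :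
    thetaTerm a c w (n + N) = thetaTerm a c (w + N) n := by
  rw [thetaTerm, thetaTerm, ha n]
  congr 2
  push_cast
  ring

theorem map_thetaTerm (f : A →+* B) (a : ℕ → A) (c w : A) (n : ℕ) :
    PowerSeries.map f (thetaTerm a c w n) = thetaTerm (fun n => f (a n)) (f c) (f w) n := by
  rw [thetaTerm, map_mul, PowerSeries.map_C, map_expSeries, thetaTerm]
  simp

theorem coeff_thetaTerm (a : ℕ → A) (c w : A) (n m : ℕ) :
    PowerSeries.coeff m (thetaTerm a c w n) =
      (-c) ^ m * algebraMap ℚ A (1 / m.factorial) * (a n * (n + w) ^ (2 * m)) := by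
  rw [thetaTerm, PowerSeries.coeff_C_mul, coeff_expSeries, mul_pow, ← pow_mul]
  ring

end ExpSeries

section RogersFine

variable {A B : Type*} [CommRing A] [CommRing B]

/-- The `q`-Pochhammer symbol `(a; q)_n`. -/
def qPoch (a q : A) (n : ℕ) : A := ∏ j ∈ Finset.range n, (1 - a * q ^ j)

theorem qPoch_succ (a q : A) (n : ℕ) : qPoch a q (n + 1) = qPoch a q n * (1 - a * q ^ n) :=
  Finset.prod_range_succ _ n

theorem qPoch_succ' (a q : A) (n : ℕ) : qPoch a q (n + 1) = (1 - a) * qPoch (a * q) q n := by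
  rw [qPoch, Finset.prod_range_succ', pow_zero, mul_one, mul_comm, qPoch]
  simp only [pow_succ', mul_assoc]

theorem map_qPoch (f : A →+* B) (a q : A) (n : ℕ) :
    f (qPoch a q n) = qPoch (f a) (f q) n := by
  simp only [qPoch, map_prod, map_sub, map_one, map_mul, map_pow]

theorem isUnit_qPoch {a q : A} (h : ∀ j, IsUnit (1 - a * q ^ j)) (n : ℕ) : IsUnit (qPoch a q n) :=
  IsUnit.prod_iff.2 fun j _ => h j

theorem map_ringInverse (f : A →+* B) {u : A} (hu : IsUnit u) : f u⁻¹ʳ = (f u)⁻¹ʳ := by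
  rw [← one_mul (f u)⁻¹ʳ, Ring.eq_mul_inverse_iff_mul_eq _ _ _ (hu.map f), ← map_mul,
    Ring.inverse_mul_cancel u hu, map_one]

/-- The `M`-th partial sum of the Rogers–Fine series `∑ (α; q)_n / (β; q)_n * τ ^ n`. -/
noncomputable def rogersFineSum (q α β τ : A) (M : ℕ) : A :=
  ∑ n ∈ Finset.range M, τ ^ n * qPoch α q n * (qPoch β q n)⁻¹ʳ

theorem map_rogersFineSum (f : A →+* B) {q α β τ : A} (hβ : ∀ j, IsUnit (1 - β * q ^ j)) (M : ℕ) :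
    f (rogersFineSum q α β τ M) = rogersFineSum (f q) (f α) (f β) (f τ) M := by
  simp only [rogersFineSum, map_sum, map_mul, map_pow, map_qPoch,
    map_ringInverse f (isUnit_qPoch hβ _)]

theorem rogersFineSum_functional_equation {q α β τ : A} (hβ : ∀ j, IsUnit (1 - β * q ^ j))
    (M : ℕ) :
    (1 - τ) * rogersFineSum q α β τ M = 1 - α * τ +
      τ * (β - α * τ * q) * (1 - α) * (1 - β)⁻¹ʳ *
        rogersFineSum q (α * q) (β * q) (τ * q) M -
      τ ^ M * (1 - α * τ * q ^ M) * qPoch α q M * (qPoch β q M)⁻¹ʳ := by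
  induction M with
  | zero => simp [rogersFineSum, qPoch]
  | succ M ih =>
    have hα := qPoch_succ' α q M
    have hinv : (qPoch β q (M + 1))⁻¹ʳ = (qPoch (β * q) q M)⁻¹ʳ * (1 - β)⁻¹ʳ := by
      rw [qPoch_succ', Ring.inverse_mul (.inl (by simpa using hβ 0))]
    have hinv' : (qPoch β q M)⁻¹ʳ = (1 - β * q ^ M) * (qPoch β q (M + 1))⁻¹ʳ := by
      rw [qPoch_succ, Ring.inverse_mul (.inr (hβ M)), Ring.mul_inverse_cancel_left _ _ (hβ M)]
    rw [rogersFineSum, rogersFineSum, Finset.sum_range_succ, Finset.sum_range_succ,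
      ← rogersFineSum, ← rogersFineSum, hinv']
    rw [hinv'] at ih
    linear_combination ih +
      τ ^ (M + 1) * q ^ M * (β - α * τ * q) * ((1 - α) * qPoch (α * q) q M * hinv +
        (qPoch β q (M + 1))⁻¹ʳ * (hα - qPoch_succ α q M)) +
      τ ^ (M + 1) * (1 - α * τ * q ^ (M + 1)) * (qPoch β q (M + 1))⁻¹ʳ * qPoch_succ α q M

/-- The strange sum `∑ (q; q)_n / (-q; q)_n`, deformed by a variable `x` and truncated at `M`. -/
noncomputable def deformedSum9 (q x : A) (M : ℕ) : A := rogersFineSum q (x * q) (-(x * q)) x M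

theorem isUnit_one_sub_neg_mul {q x : A} (hx : ∀ j, IsUnit (1 + x * q ^ (j + 1))) (j : ℕ) :
    IsUnit (1 - -(x * q) * q ^ j) := by
  rw [neg_mul, sub_neg_eq_add, mul_assoc, ← pow_succ']
  exact hx j

theorem map_deformedSum9 (f : A →+* B) {q x : A} (hx : ∀ j, IsUnit (1 + x * q ^ (j + 1))) (M : ℕ) :
    f (deformedSum9 q x M) = deformedSum9 (f q) (f x) M := by
  rw [deformedSum9, map_rogersFineSum f (isUnit_one_sub_neg_mul hx), map_neg, map_mul, deformedSum9]

theorem qPoch_dvd_deformedSum9 {q x : A} (hx : ∀ j, IsUnit (1 + x * q ^ (j + 1))) (M : ℕ) :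
    qPoch (x * q) q M ∣ (1 - x) * deformedSum9 q x M +
      x ^ 2 * q * (1 - x * q) * deformedSum9 q (x * q) M - (1 - x ^ 2 * q) := by
  have hunit := isUnit_one_sub_neg_mul hx
  have hinv := Ring.mul_inverse_cancel _ (hunit 0)
  rw [pow_zero, mul_one] at hinv
  have h := rogersFineSum_functional_equation (α := x * q) (τ := x) hunit M
  refine ⟨-(x ^ M * (1 - x * q * x * q ^ M) * (qPoch (-(x * q)) q M)⁻¹ʳ), ?_⟩
  rw [deformedSum9, deformedSum9, ← neg_mul (x * q) q]
  linear_combination h -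
    x ^ 2 * q * (1 - x * q) * rogersFineSum q (x * q * q) (-(x * q) * q) (x * q) M * hinv

/-- The strange sum `∑ (q²; q²)_n / (q; q²)_{n + 1}`, deformed by a variable `x` and truncated
at `M`. -/
noncomputable def deformedSum10 (q x : A) (M : ℕ) : A :=
  (1 - x * q)⁻¹ʳ * rogersFineSum (q ^ 2) (x * q ^ 2) (x * q ^ 3) x M

theorem isUnit_one_sub_mul_sq_pow {q x : A} (hx : ∀ j, IsUnit (1 - x * q ^ (2 * j + 1))) (j : ℕ) :
    IsUnit (1 - x * q ^ 3 * (q ^ 2) ^ j) := by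
  rw [mul_assoc, ← pow_mul, ← pow_add, show 3 + 2 * j = 2 * (j + 1) + 1 by ring]
  exact hx (j + 1)

theorem map_deformedSum10 (f : A →+* B) {q x : A} (hx : ∀ j, IsUnit (1 - x * q ^ (2 * j + 1)))
    (M : ℕ) : f (deformedSum10 q x M) = deformedSum10 (f q) (f x) M := by
  rw [deformedSum10, map_mul, map_ringInverse f (by simpa using hx 0),
    map_rogersFineSum f (isUnit_one_sub_mul_sq_pow hx), deformedSum10]
  simp only [map_sub, map_one, map_mul, map_pow]

theorem qPoch_dvd_deformedSum10 {q x : A} (hx : ∀ j, IsUnit (1 - x * q ^ (2 * j + 1))) (M : ℕ) :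
    qPoch (x * q ^ 2) (q ^ 2) M ∣ (1 - x) * deformedSum10 q x M -
      x ^ 2 * q ^ 3 * (1 - x * q ^ 2) * deformedSum10 q (x * q ^ 2) M - (1 + x * q) := by
  have hinv : (1 - x * q) * (1 - x * q)⁻¹ʳ = 1 :=
    Ring.mul_inverse_cancel _ (by simpa using hx 0)
  have h := rogersFineSum_functional_equation (α := x * q ^ 2) (τ := x)
    (isUnit_one_sub_mul_sq_pow hx) M
  refine ⟨-((1 - x * q)⁻¹ʳ * x ^ M * (1 - x * q ^ 2 * x * (q ^ 2) ^ M) *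
    (qPoch (x * q ^ 3) (q ^ 2) M)⁻¹ʳ), ?_⟩
  rw [deformedSum10, deformedSum10, show x * q ^ 2 * q = x * q ^ 3 by ring,
    show x * q ^ 2 * q ^ 3 = x * q ^ 3 * q ^ 2 by ring]
  linear_combination (1 - x * q)⁻¹ʳ * h + (1 + x * q + x ^ 2 * q ^ 3 * (1 - x * q ^ 2) *
    ((1 - x * q ^ 3)⁻¹ʳ *
      rogersFineSum (q ^ 2) (x * q ^ 2 * q ^ 2) (x * q ^ 3 * q ^ 2) (x * q ^ 2) M)) * hinv

end RogersFine

section AtOne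

variable {K : Type} [Field K]

theorem ringInverse_eq_inv (f : K⟦X⟧) : f⁻¹ʳ = f⁻¹ := by
  by_cases hf : IsUnit f
  · have h0 : PowerSeries.constantCoeff f ≠ 0 :=
      (PowerSeries.isUnit_iff_constantCoeff.1 hf).ne_zero
    rw [PowerSeries.eq_inv_iff_mul_eq_one h0, Ring.inverse_mul_cancel f hf]
  · rw [Ring.inverse_non_unit f hf, eq_comm, PowerSeries.inv_eq_zero]
    exact not_not.1 fun h => hf (PowerSeries.isUnit_iff_constantCoeff.2 (isUnit_iff_ne_zero.2 h))

theorem strange9_eq_qPoch (q : K⟦X⟧) (n : ℕ) : strange9 q n = qPoch q q n * (qPoch (-q) q n)⁻¹ := by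
  simp only [strange9, qPoch, pow_succ', neg_mul, sub_neg_eq_add]

theorem deformedSum9_one (q : K⟦X⟧) (M : ℕ) :
    deformedSum9 q 1 M = ∑ n ∈ Finset.range M, strange9 q n := by
  simp only [deformedSum9, rogersFineSum, strange9_eq_qPoch, ringInverse_eq_inv, one_pow, one_mul]

theorem strange10_eq_qPoch (r q : K⟦X⟧) (n : ℕ) : strange10 r q n =
    r * ((1 - q)⁻¹ * (qPoch (q ^ 2) (q ^ 2) n * (qPoch (q ^ 3) (q ^ 2) n)⁻¹)) := by
  have hnum : ∏ j ∈ Finset.range n, (1 - q ^ (2 * (j + 1))) = qPoch (q ^ 2) (q ^ 2) n :=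
    Finset.prod_congr rfl fun j _ => by ring
  have hden : ∏ j ∈ Finset.range (n + 1), (1 - q ^ (2 * j + 1)) =
      (1 - q) * qPoch (q ^ 3) (q ^ 2) n := by
    rw [Finset.prod_range_succ', mul_comm, mul_zero, zero_add, pow_one]
    exact congrArg _ (Finset.prod_congr rfl fun j _ => by ring)
  rw [strange10, hnum, hden, PowerSeries.mul_inv_rev]
  ring

theorem deformedSum10_one (r q : K⟦X⟧) (M : ℕ) :
    r * deformedSum10 q 1 M = ∑ n ∈ Finset.range M, strange10 r q n := by
  simp only [deformedSum10, rogersFineSum, strange10_eq_qPoch, ringInverse_eq_inv, one_pow, one_mul,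
    Finset.mul_sum]

end AtOne

section TAdic

variable {A : Type*} [CommRing A]

theorem X_pow_dvd_qPoch {a q : A⟦X⟧} {i k e M : ℕ} (hk : 0 < k)
    (hq : PowerSeries.constantCoeff q ^ k = 1)
    (ha : PowerSeries.constantCoeff a = PowerSeries.constantCoeff q ^ i) (hM : e * k ≤ M) :
    PowerSeries.X ^ e ∣ qPoch a q M := by
  induction e generalizing a M with
  | zero => simp
  | succ e ih =>
    obtain ⟨M, rfl⟩ := Nat.exists_eq_add_of_le ((Nat.le_mul_of_pos_left k e.succ_pos).trans hM)
    have hsplit : qPoch a q (k + M) = qPoch a q k * qPoch (a * q ^ k) q M := by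
      simp only [qPoch, Finset.prod_range_add, pow_add, mul_assoc]
    -- Among `k` consecutive factors, one has vanishing constant coefficient.
    have hfactor : (PowerSeries.X : A⟦X⟧) ∣ 1 - a * q ^ ((k - 1) * i % k) := by
      rw [PowerSeries.X_dvd_iff, map_sub, map_one, map_mul, map_pow, ha, ← pow_eq_pow_mod _ hq,
        ← pow_add, ← one_add_mul, Nat.add_sub_cancel' (Nat.one_le_iff_ne_zero.2 hk.ne'),
        pow_mul, hq, one_pow, sub_self]
    rw [hsplit, pow_succ']
    refine mul_dvd_mul (hfactor.trans (Finset.dvd_prod_of_mem _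
      (Finset.mem_range.2 (Nat.mod_lt _ hk)))) (ih ?_ ?_)
    · rw [map_mul, map_pow, hq, mul_one, ha]
    · rw [add_one_mul] at hM
      omega

theorem dvd_sub_sub_sum_range {d : A} {V g : ℕ → A} (h : ∀ i, d ∣ V i - V (i + 1) - g i) (n : ℕ) :
    d ∣ V 0 - V n - ∑ i ∈ Finset.range n, g i := by
  rw [← Finset.sum_range_sub', ← Finset.sum_sub_distrib]
  exact Finset.dvd_sum fun i _ => h i

end TAdic

section Telescoping

variable {A B : Type*} [CommRing A] [Algebra ℚ A] [CommRing B] [Algebra ℚ B]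

/-- The `i`-th term of the telescoping sequence for `∑ (q; q)_n / (-q; q)_n`: the deformed sum at
`x = q ^ (i + w)`, weighted by the `i`-th term of the partial theta series
`∑ (-z) ^ (n ^ 2) * e ^ (-(n + w) ^ 2 t)`. -/
noncomputable def telescope9 (z w : A) (M i : ℕ) : A⟦X⟧ :=
  thetaTerm (fun n => (-z) ^ n ^ 2) 1 w i * deformedSum9 (qPow z 1 0) (qPow z i w) M *
    (1 - qPow z i w) + thetaTerm (fun n => (-z) ^ n ^ 2) 1 w i

theorem isUnit_one_add_qPow_mul {z : A} (hz : ∀ j, IsUnit (1 + z ^ j)) (i : ℕ) (w : A) (j : ℕ) :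
    IsUnit (1 + qPow z i w * qPow z 1 0 ^ (j + 1)) := by
  rw [PowerSeries.isUnit_iff_constantCoeff, map_add, map_one, map_mul, map_pow, constantCoeff_qPow,
    constantCoeff_qPow, pow_one, ← pow_add]
  exact hz _

theorem map_telescope9 (f : A →+* B) {z : A} (hz : ∀ j, IsUnit (1 + z ^ j)) (w : A) (M i : ℕ) :
    PowerSeries.map f (telescope9 z w M i) = telescope9 (f z) (f w) M i := by
  simp only [telescope9, map_add, map_mul, map_sub, map_one, map_thetaTerm, map_pow, map_neg,
    map_qPow, map_zero, map_deformedSum9 _ (isUnit_one_add_qPow_mul hz i w)]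

theorem X_pow_dvd_telescope9_sub {z : A} {k e M : ℕ} (hk : 0 < k) (hzk : z ^ k = 1)
    (hz : ∀ j, IsUnit (1 + z ^ j)) (hM : e * k ≤ M) (w : A) (i : ℕ) :
    PowerSeries.X ^ e ∣ telescope9 z w M i - telescope9 z w M (i + 1) -
      2 * thetaTerm (fun n => (-z) ^ n ^ 2) 1 w i := by
  have hxq : qPow z i w * qPow z 1 0 = qPow z (i + 1) w := by rw [qPow_mul_qPow, add_zero]
  have hx2q : qPow z i w ^ 2 * qPow z 1 0 = qPow z (i * 2 + 1) (2 * w) := by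
    rw [qPow_pow, qPow_mul_qPow, add_zero, Nat.cast_two]
  have htheta : thetaTerm (fun n => (-z) ^ n ^ 2) 1 w i * (qPow z i w ^ 2 * qPow z 1 0) =
      -thetaTerm (fun n => (-z) ^ n ^ 2) 1 w (i + 1) := by
    rw [hx2q, ← neg_eq_iff_eq_neg, ← mul_neg, ← qPow_neg ⟨i, by ring⟩]
    refine thetaTerm_mul_qPow (by ring) ?_
    push_cast
    ring
  have hpoch : PowerSeries.X ^ e ∣ qPoch (qPow z i w * qPow z 1 0) (qPow z 1 0) M := by
    refine X_pow_dvd_qPoch (i := i + 1) hk ?_ ?_ hM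
    · rw [constantCoeff_qPow, pow_one, hzk]
    · rw [hxq, constantCoeff_qPow, constantCoeff_qPow, pow_one]
  have h := (hpoch.trans (qPoch_dvd_deformedSum9 (isUnit_one_add_qPow_mul hz i w) M)).mul_left
    (thetaTerm (fun n => (-z) ^ n ^ 2) 1 w i)
  rw [hxq] at h
  convert h using 1
  rw [telescope9, telescope9]
  linear_combination (-(1 - qPow z (i + 1) w) * deformedSum9 (qPow z 1 0) (qPow z (i + 1) w) M -
    1) * htheta

theorem telescope9_period {z : A} {N : ℕ} (hN : Even N) (hz : z ^ N = 1) (w : A) (M : ℕ) :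
    telescope9 z w M N = telescope9 z (w + N) M 0 := by
  have ha : Function.Periodic (fun n => (-z) ^ n ^ 2) N := fun n => by
    dsimp only
    rw [show (n + N) ^ 2 = n ^ 2 + N * (2 * n + N) by ring, pow_add, pow_mul, hN.neg_pow, hz,
      one_pow, mul_one]
  rw [telescope9, ← zero_add N, qPow_add_period hz, thetaTerm_add_period ha, zero_add, telescope9]

theorem X_pow_dvd_telescope9_sub_shift {z : A} {k e M : ℕ} (hk : 0 < k) (hzk : z ^ k = 1)
    (hz : ∀ j, IsUnit (1 + z ^ j)) (hM : e * k ≤ M) (w : A) :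
    PowerSeries.X ^ e ∣ telescope9 z w M 0 - telescope9 z (w + (2 * k : ℕ)) M 0 -
      2 * ∑ n ∈ Finset.range (2 * k), thetaTerm (fun n => (-z) ^ n ^ 2) 1 w n := by
  rw [← telescope9_period (even_two_mul k) (by rw [mul_comm, pow_mul, hzk, one_pow]),
    Finset.mul_sum]
  exact dvd_sub_sub_sum_range (X_pow_dvd_telescope9_sub hk hzk hz hM w) _

/-- The `i`-th term of the telescoping sequence for `∑ (q²; q²)_n / (q; q²)_{n + 1}`: the deformed
sum at `x = q ^ (2 i + w / 2)`, weighted by the term of index `4 i + 1` of the partial theta series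
`∑ a n * e ^ (-c (n + w) ^ 2 t)`. Here `c` stands for `1 / 8`. -/
noncomputable def telescope10 (a : ℕ → A) (c z w : A) (M i : ℕ) : A⟦X⟧ :=
  thetaTerm a c w (4 * i + 1) * deformedSum10 (qPow z 1 0) (qPow z (2 * i) (4 * c * w)) M *
    (1 - qPow z (2 * i) (4 * c * w))

theorem isUnit_one_sub_qPow_mul {z : A} (hz : ∀ j, IsUnit (1 - z ^ (2 * j + 1))) (i : ℕ) (p : A)
    (j : ℕ) : IsUnit (1 - qPow z (2 * i) p * qPow z 1 0 ^ (2 * j + 1)) := by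
  rw [PowerSeries.isUnit_iff_constantCoeff, map_sub, map_one, map_mul, map_pow, constantCoeff_qPow,
    constantCoeff_qPow, pow_one, ← pow_add, ← add_assoc, ← mul_add]
  exact hz _

theorem map_telescope10 (f : A →+* B) (a : ℕ → A) (c : A) {z : A}
    (hz : ∀ j, IsUnit (1 - z ^ (2 * j + 1))) (w : A) (M i : ℕ) :
    PowerSeries.map f (telescope10 a c z w M i) =
      telescope10 (fun n => f (a n)) (f c) (f z) (f w) M i := by
  simp only [telescope10, map_mul, map_sub, map_one, map_thetaTerm, map_qPow, map_zero,
    map_ofNat, map_deformedSum10 _ (isUnit_one_sub_qPow_mul hz i (4 * c * w))]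

theorem thetaTerm_odd_mul_qPow {a : ℕ → A} {c z : A} (hc : 8 * c = 1)
    (ha : ∀ i, a (2 * i + 3) = a (2 * i + 1) * z ^ (i + 1)) (w : A) (i : ℕ) :
    thetaTerm a c w (2 * i + 1) * qPow z (i + 1) (4 * c * w) = thetaTerm a c w (2 * i + 3) := by
  refine thetaTerm_mul_qPow (ha i) ?_
  push_cast
  linear_combination (i + 1) * hc

theorem X_pow_dvd_telescope10_sub {a : ℕ → A} {c z : A} {k e M : ℕ} (hk : 0 < k) (hzk : z ^ k = 1)
    (hz : ∀ j, IsUnit (1 - z ^ (2 * j + 1))) (hc : 8 * c = 1)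
    (ha : ∀ i, a (2 * i + 3) = a (2 * i + 1) * z ^ (i + 1)) (hM : e * k ≤ M) (w : A) (i : ℕ) :
    PowerSeries.X ^ e ∣ telescope10 a c z w M i - telescope10 a c z w M (i + 1) -
      (thetaTerm a c w (4 * i + 1) + thetaTerm a c w (4 * i + 3)) := by
  have hxq : qPow z (2 * i) (4 * c * w) * qPow z 1 0 = qPow z (2 * i + 1) (4 * c * w) := by
    rw [qPow_mul_qPow, add_zero]
  have hxq2 : qPow z (2 * i) (4 * c * w) * qPow z 1 0 ^ 2 =
      qPow z (2 * (i + 1)) (4 * c * w) := by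
    rw [qPow_pow, qPow_mul_qPow, mul_zero, add_zero, one_mul, mul_add_one]
  have htheta3 := thetaTerm_odd_mul_qPow hc ha w (2 * i)
  have htheta5 := thetaTerm_odd_mul_qPow hc ha w (2 * i + 1)
  rw [show 2 * (2 * i) + 1 = 4 * i + 1 by ring, show 2 * (2 * i) + 3 = 4 * i + 3 by ring,
    ← hxq] at htheta3
  rw [show 2 * (2 * i + 1) + 1 = 4 * i + 3 by ring, show 2 * i + 1 + 1 = 2 * (i + 1) by ring,
    show 2 * (2 * i + 1) + 3 = 4 * (i + 1) + 1 by ring, ← hxq2, ← htheta3] at htheta5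
  have hpoch : PowerSeries.X ^ e ∣
      qPoch (qPow z (2 * i) (4 * c * w) * qPow z 1 0 ^ 2) (qPow z 1 0 ^ 2) M := by
    refine X_pow_dvd_qPoch (i := i + 1) hk ?_ ?_ hM
    · rw [map_pow, constantCoeff_qPow, pow_one, pow_right_comm, hzk, one_pow]
    · rw [hxq2, map_pow, constantCoeff_qPow, constantCoeff_qPow, pow_one, pow_mul]
  have h := (hpoch.trans (qPoch_dvd_deformedSum10 (isUnit_one_sub_qPow_mul hz i _) M)).mul_left
    (thetaTerm a c w (4 * i + 1))
  convert h using 1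
  rw [telescope10, telescope10, ← hxq2]
  linear_combination htheta3 + (1 - qPow z (2 * i) (4 * c * w) * qPow z 1 0 ^ 2) *
    deformedSum10 (qPow z 1 0) (qPow z (2 * i) (4 * c * w) * qPow z 1 0 ^ 2) M * htheta5

theorem telescope10_period {a : ℕ → A} {c z : A} {k : ℕ} (hzk : z ^ k = 1) (hc : 8 * c = 1)
    (ha : Function.Periodic a (4 * k)) (w : A) (M : ℕ) :
    telescope10 a c z w M k = telescope10 a c z (w + (4 * k : ℕ)) M 0 := by
  have hw : 4 * c * w + (2 * k : ℕ) = 4 * c * (w + (4 * k : ℕ)) := by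
    push_cast
    linear_combination -2 * k * hc
  rw [telescope10, ← zero_add (2 * k), add_comm (4 * k),
    qPow_add_period (by rw [mul_comm, pow_mul, hzk, one_pow]), thetaTerm_add_period ha, hw,
    telescope10, mul_zero, mul_zero, zero_add]

theorem sum_range_four_mul {M : Type*} [AddCommMonoid M] {g : ℕ → M} (hg : ∀ n, Even n → g n = 0)
    (k : ℕ) : ∑ n ∈ Finset.range (4 * k), g n =
      ∑ i ∈ Finset.range k, (g (4 * i + 1) + g (4 * i + 3)) := by
  induction k with
  | zero => simp
  | succ k ih =>
    rw [mul_add_one, Finset.sum_range_succ, Finset.sum_range_succ, Finset.sum_range_succ,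
      Finset.sum_range_succ, ih, Finset.sum_range_succ, hg (4 * k) ⟨2 * k, by ring⟩,
      hg (4 * k + 2) ⟨2 * k + 1, by ring⟩, add_zero, add_zero, add_assoc]

theorem X_pow_dvd_telescope10_sub_shift {a : ℕ → A} {c z : A} {k e M : ℕ} (hk : 0 < k)
    (hzk : z ^ k = 1) (hz : ∀ j, IsUnit (1 - z ^ (2 * j + 1))) (hc : 8 * c = 1)
    (ha : ∀ i, a (2 * i + 3) = a (2 * i + 1) * z ^ (i + 1)) (heven : ∀ n, Even n → a n = 0)
    (hper : Function.Periodic a (4 * k)) (hM : e * k ≤ M) (w : A) :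
    PowerSeries.X ^ e ∣ telescope10 a c z w M 0 - telescope10 a c z (w + (4 * k : ℕ)) M 0 -
      ∑ n ∈ Finset.range (4 * k), thetaTerm a c w n := by
  rw [← telescope10_period hzk hc hper, sum_range_four_mul fun n hn => by
    rw [thetaTerm, heven n hn, map_zero, zero_mul]]
  exact dvd_sub_sub_sum_range (X_pow_dvd_telescope10_sub hk hzk hz hc ha hM w) _

end Telescoping

section DerivAtZero

/-- The derivative in `w`, at `w = 0`, of a power series in `t` with coefficients in `ℂ[w]`. -/
noncomputable def derivAtZero (V : ℂ[X]⟦X⟧) : ℂ⟦X⟧ :=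
  PowerSeries.mk fun m => (Polynomial.derivative (PowerSeries.coeff m V)).eval 0

theorem derivAtZero_add (V W : ℂ[X]⟦X⟧) :
    derivAtZero (V + W) = derivAtZero V + derivAtZero W := by
  ext m
  simp only [derivAtZero, PowerSeries.coeff_mk, map_add, Polynomial.eval_add]

theorem derivAtZero_mul (V W : ℂ[X]⟦X⟧) : derivAtZero (V * W) =
    derivAtZero V * PowerSeries.map (Polynomial.evalRingHom 0) W +
      PowerSeries.map (Polynomial.evalRingHom 0) V * derivAtZero W := by
  ext m
  simp only [derivAtZero, PowerSeries.coeff_mk, map_add, PowerSeries.coeff_mul,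
    PowerSeries.coeff_map, Polynomial.derivative_sum, Polynomial.eval_finsetSum,
    Polynomial.derivative_mul, Polynomial.eval_add, Polynomial.eval_mul,
    Polynomial.coe_evalRingHom, Finset.sum_add_distrib]

theorem derivAtZero_expSeries {p : ℂ[X]} (hp : p.eval 0 = 0) : derivAtZero (expSeries p) =
    PowerSeries.C ((Polynomial.derivative p).eval 0) * PowerSeries.X := by
  ext m
  rw [derivAtZero, PowerSeries.coeff_mk, coeff_expSeries, PowerSeries.coeff_C_mul,
    PowerSeries.coeff_X, Polynomial.derivative_mul, Polynomial.derivative_pow]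
  rcases m with _ | _ | m <;> simp [hp]

theorem derivAtZero_mul_one_sub_expSeries (V : ℂ[X]⟦X⟧) {p : ℂ[X]} (hp : p.eval 0 = 0) :
    derivAtZero (V * (1 - expSeries p)) = -(PowerSeries.C ((Polynomial.derivative p).eval 0) *
      (PowerSeries.X * PowerSeries.map (Polynomial.evalRingHom 0) V)) := by
  have hone : derivAtZero 1 = 0 := by
    ext m
    rw [derivAtZero, PowerSeries.coeff_mk, PowerSeries.coeff_one]
    split_ifs <;> simp
  have hsub : derivAtZero (1 - expSeries p) = -derivAtZero (expSeries p) := by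
    rw [eq_neg_iff_add_eq_zero, ← derivAtZero_add, sub_add_cancel, hone]
  rw [derivAtZero_mul, hsub, derivAtZero_expSeries hp, map_sub, map_one, map_expSeries,
    Polynomial.coe_evalRingHom, hp, expSeries_zero]
  ring

theorem IsEntireContinuation.coeff_derivAtZero_eq {a : ℕ → ℂ} {N : ℕ} [NeZero N] {L : ℂ → ℂ}
    (hL : IsEntireContinuation a L) (ha : Function.Periodic a N)
    (h0 : ∑ n ∈ Finset.range N, a n = 0) {b c : ℂ} {V : ℂ[X]⟦X⟧} {m : ℕ}
    (hV : ∀ w : ℂ, PowerSeries.X ^ (m + 2) ∣ PowerSeries.map (Polynomial.evalRingHom w) V -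
      PowerSeries.map (Polynomial.evalRingHom (w + N)) V -
        PowerSeries.C b * ∑ n ∈ Finset.range N, thetaTerm a c w n) :
    PowerSeries.coeff (m + 1) (derivAtZero V) =
      2 * b * (-c) ^ (m + 1) / m.factorial * L (-2 * m - 1) := by
  have hp : ∀ w : ℂ, (PowerSeries.coeff (m + 1) V).eval w -
      (PowerSeries.coeff (m + 1) V).eval (w + N) = b * (-c) ^ (m + 1) / (m + 1).factorial *
        ∑ n ∈ Finset.range N, a n * (n + w) ^ (2 * m + 1 + 1) := fun w => by
    have h := PowerSeries.X_pow_dvd_iff.1 (hV w) (m + 1) (by omega)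
    simp only [map_sub, PowerSeries.coeff_map, Polynomial.coe_evalRingHom, PowerSeries.coeff_C_mul,
      map_sum, coeff_thetaTerm, ← Finset.mul_sum, sub_eq_zero, mul_add_one 2 m] at h
    rw [h]
    simp
    ring
  rw [derivAtZero, PowerSeries.coeff_mk, hL.derivative_eval_zero_eq ha h0 (2 * m).succ_ne_zero hp,
    Nat.factorial_succ]
  push_cast
  have hm : (m + 1 : ℂ) ≠ 0 := by exact_mod_cast m.succ_ne_zero
  rw [neg_add, ← sub_eq_add_neg, neg_mul_eq_neg_mul]
  field_simp
  ring

end DerivAtZero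

section Asymptotics

/-- The function `f` has the asymptotic expansion `F` as `t ↘ 0`. -/
def HasExpansion (f : ℝ → ℂ) (F : ℂ⟦X⟧) : Prop :=
  ∀ N : ℕ, (fun t : ℝ => f t - (PowerSeries.trunc N F).eval (t : ℂ)) =O[𝓝[>] (0 : ℝ)]
    fun t : ℝ => t ^ N

theorem eval_trunc (N : ℕ) (F : ℂ⟦X⟧) (z : ℂ) :
    (PowerSeries.trunc N F).eval z = ∑ m ∈ Finset.range N, PowerSeries.coeff m F * z ^ m := by
  rw [Polynomial.eval, PowerSeries.eval₂_trunc_eq_sum_range]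
  rfl

theorem isBigO_ofReal_pow (N : ℕ) :
    (fun t : ℝ => (t : ℂ) ^ N) =O[𝓝[>] (0 : ℝ)] fun t : ℝ => t ^ N :=
  isBigO_of_le _ fun t => by rw [norm_pow, norm_pow, Complex.norm_real]

theorem isBigO_one_eval (p : ℂ[X]) :
    (fun t : ℝ => p.eval (t : ℂ)) =O[𝓝[>] (0 : ℝ)] fun _ => (1 : ℝ) := by
  have hcont : Continuous fun t : ℝ => p.eval (t : ℂ) := p.continuous.comp Complex.continuous_ofReal
  exact (hcont.continuousAt.tendsto.mono_left nhdsWithin_le_nhds).isBigO_one ℝ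

theorem isBigO_eval_sub_eval {p r : ℂ[X]} {N : ℕ} (h : ∀ i < N, p.coeff i = r.coeff i) :
    (fun t : ℝ => p.eval (t : ℂ) - r.eval (t : ℂ)) =O[𝓝[>] (0 : ℝ)] fun t : ℝ => t ^ N := by
  obtain ⟨s, hs⟩ : Polynomial.X ^ N ∣ p - r :=
    Polynomial.X_pow_dvd_iff.2 fun i hi => by rw [Polynomial.coeff_sub, h i hi, sub_self]
  simpa only [← Polynomial.eval_sub, hs, Polynomial.eval_mul, Polynomial.eval_pow,
    Polynomial.eval_X, mul_one] using (isBigO_ofReal_pow N).mul (isBigO_one_eval s)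

namespace HasExpansion

variable {f g : ℝ → ℂ} {F G : ℂ⟦X⟧}

theorem tendsto (hf : HasExpansion f F) :
    Tendsto f (𝓝[>] 0) (𝓝 (PowerSeries.constantCoeff F)) := by
  have hpow : Tendsto (fun t : ℝ => t ^ 1) (𝓝[>] 0) (𝓝 0) :=
    ((continuous_pow 1).tendsto' 0 0 (zero_pow one_ne_zero)).mono_left nhdsWithin_le_nhds
  simpa [PowerSeries.trunc_one_left] using
    ((hf 1).trans_tendsto hpow).add_const (PowerSeries.constantCoeff F)

theorem isBigO_one (hf : HasExpansion f F) : f =O[𝓝[>] (0 : ℝ)] fun _ => (1 : ℝ) :=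
  hf.tendsto.isBigO_one ℝ

theorem polynomial (p : ℂ[X]) : HasExpansion (fun t => p.eval (t : ℂ)) (p : ℂ⟦X⟧) :=
  fun N => isBigO_eval_sub_eval fun i hi => by simp [PowerSeries.coeff_trunc, hi]

theorem const (c : ℂ) : HasExpansion (fun _ => c) (PowerSeries.C c) := by
  simpa using polynomial (Polynomial.C c)

theorem one : HasExpansion (fun _ => 1) 1 := by
  simpa using const 1

theorem exp (a : ℂ) : HasExpansion (fun t => Complex.exp (a * t)) (expSeries a) := fun N => by
  have htrunc : ∀ t : ℝ, (PowerSeries.trunc N (expSeries a)).eval (t : ℂ) =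
      ∑ m ∈ Finset.range N, (a * t) ^ m / (m.factorial : ℂ) := fun t => by
    rw [eval_trunc]
    refine Finset.sum_congr rfl fun m _ => ?_
    rw [coeff_expSeries, map_div₀, map_one, map_natCast, mul_pow]
    ring
  have hlim : Tendsto (fun t : ℝ => a * (t : ℂ)) (𝓝[>] 0) (𝓝 0) := by
    have hcont : Continuous fun t : ℝ => a * (t : ℂ) := by fun_prop
    exact (hcont.tendsto' 0 0 (by simp)).mono_left nhdsWithin_le_nhds
  simp only [htrunc]
  refine ((Complex.exp_sub_sum_range_isBigO_pow N).comp_tendsto hlim).trans ?_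
  simpa only [Function.comp_def, mul_pow] using (isBigO_ofReal_pow N).const_mul_left (a ^ N)

theorem add (hf : HasExpansion f F) (hg : HasExpansion g G) :
    HasExpansion (fun t => f t + g t) (F + G) := fun N => by
  refine ((hf N).add (hg N)).congr_left fun t => ?_
  rw [map_add, Polynomial.eval_add]
  ring

theorem sub (hf : HasExpansion f F) (hg : HasExpansion g G) :
    HasExpansion (fun t => f t - g t) (F - G) := fun N => by
  refine ((hf N).sub (hg N)).congr_left fun t => ?_
  rw [map_sub, Polynomial.eval_sub]
  ring

theorem mul (hf : HasExpansion f F) (hg : HasExpansion g G) :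
    HasExpansion (fun t => f t * g t) (F * G) := fun N => by
  set p := PowerSeries.trunc N F
  set r := PowerSeries.trunc N G
  have hleft := hf.isBigO_one.mul (hg N)
  have hright := (hf N).mul (isBigO_one_eval r)
  have htrunc : (fun t : ℝ => (p * r).eval (t : ℂ) -
      (PowerSeries.trunc N (F * G)).eval (t : ℂ)) =O[𝓝[>] (0 : ℝ)] fun t : ℝ => t ^ N := by
    refine isBigO_eval_sub_eval fun i hi => ?_
    rw [← PowerSeries.trunc_trunc_mul_trunc, PowerSeries.coeff_trunc, if_pos hi,
      ← Polynomial.coe_mul, Polynomial.coeff_coe]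
  simp only [one_mul] at hleft
  simp only [mul_one] at hright
  refine ((hleft.add hright).add htrunc).congr_left fun t => ?_
  rw [Polynomial.eval_mul]
  ring

theorem pow (hf : HasExpansion f F) (n : ℕ) : HasExpansion (fun t => f t ^ n) (F ^ n) := by
  induction n with
  | zero => simpa using one
  | succ n ih => simpa only [pow_succ] using ih.mul hf

theorem sum {ι : Type*} (s : Finset ι) {f : ι → ℝ → ℂ} {F : ι → ℂ⟦X⟧}
    (h : ∀ i, HasExpansion (f i) (F i)) :
    HasExpansion (fun t => ∑ i ∈ s, f i t) (∑ i ∈ s, F i) := by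
  classical
  induction s using Finset.induction_on with
  | empty => simpa using const 0
  | insert i s hi ih => simpa only [Finset.sum_insert hi] using (h i).add ih

theorem prod {ι : Type*} (s : Finset ι) {f : ι → ℝ → ℂ} {F : ι → ℂ⟦X⟧}
    (h : ∀ i, HasExpansion (f i) (F i)) :
    HasExpansion (fun t => ∏ i ∈ s, f i t) (∏ i ∈ s, F i) := by
  classical
  induction s using Finset.induction_on with
  | empty => simpa using one
  | insert i s hi ih => simpa only [Finset.prod_insert hi] using (h i).mul ih

theorem inv (hf : HasExpansion f F) (h0 : PowerSeries.constantCoeff F ≠ 0) :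
    HasExpansion (fun t => (f t)⁻¹) F⁻¹ := fun N => by
  set r := PowerSeries.trunc N F⁻¹
  have hmul : (fun t => f t * r.eval (t : ℂ) - (PowerSeries.trunc N 1).eval (t : ℂ))
      =O[𝓝[>] (0 : ℝ)] fun t : ℝ => t ^ N := by
    have h := hf.mul (polynomial r) N
    rwa [PowerSeries.trunc_mul_trunc, PowerSeries.mul_inv_cancel _ h0] at h
  have hbound : (fun t => (f t)⁻¹) =O[𝓝[>] (0 : ℝ)] fun _ => (1 : ℝ) :=
    (hf.tendsto.inv₀ h0).isBigO_one ℝ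
  have hdiff := hbound.mul ((one N).sub hmul)
  simp only [one_mul] at hdiff
  refine hdiff.congr' ?_ EventuallyEq.rfl
  filter_upwards [hf.tendsto.eventually_ne h0] with t ht
  field_simp
  ring

end HasExpansion

theorem IsFormalSum.hasStrangeAsymptotics {u : ℕ → ℝ → ℂ} {U : ℕ → ℂ⟦X⟧} {c : ℕ → ℂ}
    (hU : IsFormalSum U c) (hu : ∀ n, HasExpansion (u n) (U n)) :
    HasStrangeAsymptotics u c := fun N => by
  filter_upwards [(Filter.eventually_all_finset (Finset.range N)).2 fun m _ => hU m] with M hM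
  refine (HasExpansion.sum (Finset.range M) hu N).congr_left fun t => ?_
  rw [eval_trunc, Finset.sum_congr rfl fun m hm => by rw [hM m hm]]

end Asymptotics

section StrangeSummands

variable {α : ℝ}

theorem zetaPow_add (α x y : ℝ) : zetaPow α (x + y) = zetaPow α x * zetaPow α y := by
  rw [zetaPow, zetaPow, zetaPow, ← Complex.exp_add]
  congr 1
  push_cast
  ring

theorem zetaPow_natCast (α : ℝ) (n : ℕ) : zetaPow α n = zetaPow α 1 ^ n := by
  rw [zetaPow, zetaPow, ← Complex.exp_nat_mul]
  congr 1
  push_cast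
  ring

theorem qSer_eq_qPow (α : ℝ) : qSer α = qPow (zetaPow α 1) 1 0 := by
  rw [qPow, pow_one, Nat.cast_one, add_zero]
  rfl

theorem constantCoeff_qSer_pow (α : ℝ) (n : ℕ) :
    PowerSeries.constantCoeff (qSer α ^ n) = zetaPow α 1 ^ n := by
  rw [map_pow, qSer_eq_qPow, constantCoeff_qPow, pow_one]

theorem hasExpansion_qFun (α : ℝ) : HasExpansion (qFun α) (qSer α) := by
  have h := (HasExpansion.const (zetaPow α 1)).mul (HasExpansion.exp (-1))
  simp only [neg_one_mul] at h
  exact h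

theorem hasExpansion_qEighthFun (α : ℝ) : HasExpansion (qEighthFun α) (qEighthSer α) := by
  have h := (HasExpansion.const (zetaPow α (1 / 8))).mul (HasExpansion.exp (-1 / 8))
  simp only [div_mul_eq_mul_div, neg_one_mul] at h
  exact h

theorem hasExpansion_H9Fun (hζ : ∀ j, 1 + zetaPow α 1 ^ j ≠ 0) (n : ℕ) :
    HasExpansion (H9Fun α n) (H9Ser α n) := by
  have hnum := HasExpansion.prod (Finset.range n) fun j =>
    HasExpansion.one.sub ((hasExpansion_qFun α).pow (j + 1))
  have hden := HasExpansion.prod (Finset.range n) fun j =>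
    HasExpansion.one.add ((hasExpansion_qFun α).pow (j + 1))
  refine (HasExpansion.const (-(1 / 4))).mul (hnum.mul (hden.inv ?_))
  simp only [map_prod, map_add, map_one, constantCoeff_qSer_pow]
  exact Finset.prod_ne_zero_iff.2 fun j _ => hζ _

theorem hasExpansion_H10Fun (hζ : ∀ j, 1 - zetaPow α 1 ^ (2 * j + 1) ≠ 0) (n : ℕ) :
    HasExpansion (H10Fun α n) (H10Ser α n) := by
  have hnum := HasExpansion.prod (Finset.range n) fun j =>
    HasExpansion.one.sub ((hasExpansion_qFun α).pow (2 * (j + 1)))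
  have hden := HasExpansion.prod (Finset.range (n + 1)) fun j =>
    HasExpansion.one.sub ((hasExpansion_qFun α).pow (2 * j + 1))
  refine (HasExpansion.const (-2)).mul
    (((hasExpansion_qEighthFun α).mul hnum).mul (hden.inv ?_))
  simp only [map_prod, map_sub, map_one, constantCoeff_qSer_pow]
  exact Finset.prod_ne_zero_iff.2 fun j _ => hζ _

end StrangeSummands

section RootsOfUnity

variable {R : Type*} [CommRing R] {z : R} {k : ℕ}

theorem one_add_pow_ne_zero_of_odd [NeZero (2 : R)] (hk : Odd k) (hz : z ^ k = 1) (j : ℕ) :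
    1 + z ^ j ≠ 0 := fun h => by
  have hpow : (z ^ j) ^ k = 1 := by rw [pow_right_comm, hz, one_pow]
  rw [eq_neg_of_add_eq_zero_right h, hk.neg_one_pow] at hpow
  exact two_ne_zero (one_add_one_eq_two.symm.trans (neg_eq_iff_add_eq_zero.1 hpow))

theorem one_sub_pow_odd_ne_zero (hz : IsPrimitiveRoot z (2 * k)) (j : ℕ) :
    1 - z ^ (2 * j + 1) ≠ 0 := fun h => by
  have hdvd := (Dvd.intro _ rfl).trans ((hz.pow_eq_one_iff_dvd _).1 (sub_eq_zero.1 h).symm)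
  omega

theorem pow_half_eq_neg_one [NoZeroDivisors R] (hk : 0 < k) (hz : IsPrimitiveRoot z (2 * k)) :
    z ^ k = -1 :=
  (hz.pow (by omega) (mul_comm 2 k)).eq_neg_one_of_two_right

end RootsOfUnity

section OddOrder

variable {α : ℝ} {k : ℕ}

theorem derivAtZero_telescope9 {z : ℂ} (hz : ∀ j, IsUnit (1 + Polynomial.C z ^ j)) (M : ℕ) :
    derivAtZero (telescope9 (Polynomial.C z) Polynomial.X M 0) =
      PowerSeries.X * ∑ n ∈ Finset.range M, strange9 (qPow z 1 0) n := by
  have htheta : derivAtZero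
      (thetaTerm (fun n => (-Polynomial.C z) ^ n ^ 2) 1 Polynomial.X 0) = 0 := by
    have h := derivAtZero_expSeries (p := -(Polynomial.X * Polynomial.X)) (by simp)
    simpa [thetaTerm, sq, Polynomial.derivative_mul] using h
  have hunit := isUnit_one_add_qPow_mul hz 0 Polynomial.X
  rw [qPow_zero] at hunit
  rw [telescope9, derivAtZero_add, htheta, qPow_zero, derivAtZero_mul_one_sub_expSeries _ (by simp),
    map_mul, map_thetaTerm, map_deformedSum9 _ hunit, map_qPow, map_expSeries]
  simp [thetaTerm, expSeries_zero, deformedSum9_one]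

theorem coeffL1_antiperiodic (hk : Odd k) (hζ : zetaPow α 1 ^ k = 1) :
    Function.Antiperiodic (coeffL1 α) k := fun n => by
  rw [coeffL1, coeffL1, show (n + k) ^ 2 = n ^ 2 + k * (2 * n + k) by ring, pow_add, pow_mul,
    hk.neg_pow, hζ, ((even_two_mul n).add_odd hk).neg_one_pow, mul_neg_one]

theorem exists_isEntireContinuation_coeffL1 (hk : Odd k) (hζ : zetaPow α 1 ^ k = 1) :
    ∃ L, IsEntireContinuation (coeffL1 α) L := by
  have : NeZero (2 * k) := ⟨by have := hk.pos; positivity⟩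
  have ha := coeffL1_antiperiodic hk hζ
  exact ⟨_, isEntireContinuation_LFunction ha.periodic_two_mul
    (sum_range_two_mul_eq_zero_of_antiperiodic ha)⟩

theorem isFormalSum_H9Ser (hk : Odd k) (hζ : zetaPow α 1 ^ k = 1) {L : ℂ → ℂ}
    (hL : IsEntireContinuation (coeffL1 α) L) :
    IsFormalSum (H9Ser α) fun n => L (-2 * (n : ℂ) - 1) * (-1) ^ n / (n.factorial : ℂ) := by
  intro m
  filter_upwards [eventually_ge_atTop ((m + 2) * k)] with M hM
  have hunit : ∀ j, IsUnit (1 + zetaPow α 1 ^ j) := fun j =>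
    (one_add_pow_ne_zero_of_odd hk hζ j).isUnit
  have hunitC : ∀ j, IsUnit (1 + Polynomial.C (zetaPow α 1) ^ j) := fun j => by
    simpa using (hunit j).map Polynomial.C
  have : NeZero (2 * k) := ⟨by have := hk.pos; positivity⟩
  have ha := coeffL1_antiperiodic hk hζ
  have hcoeff := hL.coeff_derivAtZero_eq (b := 2) (c := 1) (m := m) ha.periodic_two_mul
    (sum_range_two_mul_eq_zero_of_antiperiodic ha)
    (V := telescope9 (Polynomial.C (zetaPow α 1)) Polynomial.X M 0) fun w => by
      rw [map_telescope9 _ hunitC, map_telescope9 _ hunitC, map_ofNat]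
      simp only [Polynomial.coe_evalRingHom, Polynomial.eval_C, Polynomial.eval_X]
      exact X_pow_dvd_telescope9_sub_shift hk.pos hζ hunit hM w
  rw [derivAtZero_telescope9 hunitC, PowerSeries.coeff_succ_X_mul, ← qSer_eq_qPow] at hcoeff
  simp only [H9Ser, ← Finset.mul_sum]
  rw [PowerSeries.coeff_C_mul, hcoeff]
  ring

end OddOrder

section EvenOrder

variable {α : ℝ} {k : ℕ}

theorem derivAtZero_telescope10 {a : ℕ → ℂ} {c z : ℂ}
    (hz : ∀ j, IsUnit (1 - Polynomial.C z ^ (2 * j + 1))) (M : ℕ) :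
    derivAtZero (telescope10 (fun n => Polynomial.C (a n)) (Polynomial.C c) (Polynomial.C z)
      Polynomial.X M 0) = PowerSeries.C (4 * c) * (PowerSeries.X *
        (thetaTerm a c 0 1 * deformedSum10 (qPow z 1 0) 1 M)) := by
  have hunit := isUnit_one_sub_qPow_mul hz 0 (4 * Polynomial.C c * Polynomial.X)
  rw [mul_zero, qPow_zero] at hunit
  rw [telescope10, mul_zero, qPow_zero, derivAtZero_mul_one_sub_expSeries _ (by simp), map_mul,
    map_thetaTerm, map_deformedSum10 _ hunit, map_qPow, map_expSeries]
  simp [expSeries_zero]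

/-- The coefficients `ζ ^ (n² / 8)` for odd `n`, and `0` for even `n`: unlike `coeffL2`, which does
not vanish at `n = 0` because `J(2 | 0) = 1`, they form a periodic sequence. -/
noncomputable def oddCoeff (α : ℝ) (n : ℕ) : ℂ :=
  if Odd n then zetaPow α ((n : ℝ) ^ 2 / 8) else 0

theorem oddCoeff_of_odd (α : ℝ) {n : ℕ} (hn : Odd n) :
    oddCoeff α n = zetaPow α ((n : ℝ) ^ 2 / 8) := if_pos hn

theorem oddCoeff_of_even (α : ℝ) {n : ℕ} (hn : Even n) : oddCoeff α n = 0 :=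
  if_neg (Nat.not_odd_iff_even.2 hn)

theorem coeffL2_eq_oddCoeff (α : ℝ) {n : ℕ} (hn : n ≠ 0) : coeffL2 α n = oddCoeff α n := by
  rcases Nat.even_or_odd n with he | ho
  · have hgcd : Int.gcd 2 n ≠ 1 := fun hg => by
      have : 2 ∣ Int.gcd 2 n := Int.dvd_gcd (by norm_num) (by exact_mod_cast he.two_dvd)
      omega
    rw [oddCoeff_of_even α he, coeffL2, jacobiSym.eq_zero_iff.2 ⟨hn, hgcd⟩, Int.cast_zero,
      zero_pow two_ne_zero, zero_mul]
  · rw [oddCoeff_of_odd α ho, coeffL2, ← Int.cast_pow,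
      jacobiSym.sq_one (by exact_mod_cast Nat.coprime_two_left.2 ho), Int.cast_one, one_mul]

theorem isEntireContinuation_coeffL2_iff {L : ℂ → ℂ} :
    IsEntireContinuation (coeffL2 α) L ↔ IsEntireContinuation (oddCoeff α) L :=
  and_congr_right fun _ => forall₂_congr fun s _ =>
    LSeriesHasSum_congr s (L s) fun hn => coeffL2_eq_oddCoeff α hn

theorem oddCoeff_add {n r s : ℕ} (hn : Odd n) (hr : Even r) (hs : 2 * n * r + r ^ 2 = 8 * s) :
    oddCoeff α (n + r) = oddCoeff α n * zetaPow α 1 ^ s := by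
  rw [oddCoeff_of_odd α hn, oddCoeff_of_odd α (hn.add_even hr), ← zetaPow_natCast, ← zetaPow_add]
  congr 1
  have : (2 * n * r + r ^ 2 : ℝ) = 8 * s := by exact_mod_cast hs
  push_cast
  linear_combination this / 8

theorem oddCoeff_antiperiodic (hζ : zetaPow α 1 ^ k = -1) :
    Function.Antiperiodic (oddCoeff α) (4 * k) := fun n => by
  have h4k : Even (4 * k) := ⟨2 * k, by ring⟩
  rcases Nat.even_or_odd n with he | ho
  · rw [oddCoeff_of_even α he, oddCoeff_of_even α (he.add h4k), neg_zero]
  · rw [oddCoeff_add ho h4k (s := k * (n + 2 * k)) (by ring), pow_mul, hζ,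
      (ho.add_even (even_two_mul k)).neg_one_pow, mul_neg_one]

theorem thetaTerm_oddCoeff_one (α : ℝ) : thetaTerm (oddCoeff α) (1 / 8) 0 1 = qEighthSer α := by
  rw [thetaTerm, oddCoeff_of_odd α odd_one, qEighthSer, expSeries]
  norm_num

theorem exists_isEntireContinuation_coeffL2 (hk : 0 < k) (hζ : zetaPow α 1 ^ k = -1) :
    ∃ L, IsEntireContinuation (coeffL2 α) L := by
  have : NeZero (2 * (4 * k)) := ⟨by positivity⟩
  have ha := oddCoeff_antiperiodic hζ
  exact ⟨_, isEntireContinuation_coeffL2_iff.2 (isEntireContinuation_LFunction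
    ha.periodic_two_mul (sum_range_two_mul_eq_zero_of_antiperiodic ha))⟩

theorem isFormalSum_H10Ser (hk : 0 < k) (hζ : IsPrimitiveRoot (zetaPow α 1) (2 * k)) {L : ℂ → ℂ}
    (hL : IsEntireContinuation (coeffL2 α) L) :
    IsFormalSum (H10Ser α)
      fun n => L (-2 * (n : ℂ) - 1) * (-1) ^ n / (8 ^ n * (n.factorial : ℂ)) := by
  intro m
  filter_upwards [eventually_ge_atTop ((m + 2) * (2 * k))] with M hM
  have hunit : ∀ j, IsUnit (1 - zetaPow α 1 ^ (2 * j + 1)) := fun j =>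
    (one_sub_pow_odd_ne_zero hζ j).isUnit
  have hunitC : ∀ j, IsUnit (1 - Polynomial.C (zetaPow α 1) ^ (2 * j + 1)) := fun j => by
    simpa using (hunit j).map Polynomial.C
  have hstep : ∀ i, oddCoeff α (2 * i + 3) = oddCoeff α (2 * i + 1) * zetaPow α 1 ^ (i + 1) :=
    fun i => oddCoeff_add ⟨i, rfl⟩ even_two (by ring)
  have ha := oddCoeff_antiperiodic (pow_half_eq_neg_one hk hζ)
  have hperiod : 2 * (4 * k) = 4 * (2 * k) := by ring
  have : NeZero (4 * (2 * k)) := ⟨by positivity⟩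
  have hcoeff := (isEntireContinuation_coeffL2_iff.1 hL).coeff_derivAtZero_eq (b := 1)
    (c := 1 / 8) (m := m) (hperiod ▸ ha.periodic_two_mul)
    (hperiod ▸ sum_range_two_mul_eq_zero_of_antiperiodic ha)
    (V := telescope10 (fun n => Polynomial.C (oddCoeff α n)) (Polynomial.C (1 / 8))
      (Polynomial.C (zetaPow α 1)) Polynomial.X M 0) fun w => by
      rw [map_telescope10 _ _ _ hunitC, map_telescope10 _ _ _ hunitC, map_one, one_mul]
      simpa only [Polynomial.coe_evalRingHom, Polynomial.eval_C, Polynomial.eval_X] using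
        X_pow_dvd_telescope10_sub_shift (by omega) hζ.pow_eq_one hunit (by norm_num) hstep
          (fun n hn => oddCoeff_of_even α hn) (hperiod ▸ ha.periodic_two_mul) hM w
  rw [derivAtZero_telescope10 hunitC, thetaTerm_oddCoeff_one, deformedSum10_one,
    PowerSeries.coeff_C_mul, PowerSeries.coeff_succ_X_mul, ← qSer_eq_qPow] at hcoeff
  simp only [H10Ser, ← Finset.mul_sum]
  rw [PowerSeries.coeff_C_mul, ← mul_right_inj' (show (4 * (1 / 8) : ℂ) ≠ 0 by norm_num),
    mul_left_comm, hcoeff, neg_pow, div_pow, one_pow]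
  field_simp
  ring

end EvenOrder

theorem corollary1p1 (k : ℕ) (hk : 0 < k) (α : ℝ) (hζ : IsPrimitiveRoot (zetaPow α 1) k) :
    (Odd k →
      (∃ L₁ : ℂ → ℂ, IsEntireContinuation (coeffL1 α) L₁) ∧
      ∀ L₁ : ℂ → ℂ, IsEntireContinuation (coeffL1 α) L₁ →
        IsFormalSum (H9Ser α)
          (fun n => L₁ (-2 * (n : ℂ) - 1) * (-1) ^ n / (n.factorial : ℂ)) ∧
        HasStrangeAsymptotics (H9Fun α)
          (fun n => L₁ (-2 * (n : ℂ) - 1) * (-1) ^ n / (n.factorial : ℂ))) ∧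
    (Even k →
      (∃ L₂ : ℂ → ℂ, IsEntireContinuation (coeffL2 α) L₂) ∧
      ∀ L₂ : ℂ → ℂ, IsEntireContinuation (coeffL2 α) L₂ →
        IsFormalSum (H10Ser α)
          (fun n => L₂ (-2 * (n : ℂ) - 1) * (-1) ^ n / (8 ^ n * (n.factorial : ℂ))) ∧
        HasStrangeAsymptotics (H10Fun α)
          (fun n => L₂ (-2 * (n : ℂ) - 1) * (-1) ^ n / (8 ^ n * (n.factorial : ℂ)))) := by
  refine ⟨fun hodd => ?_, fun heven => ?_⟩
  · refine ⟨exists_isEntireContinuation_coeffL1 hodd hζ.pow_eq_one, fun L hL => ?_⟩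
    have hsum := isFormalSum_H9Ser hodd hζ.pow_eq_one hL
    exact ⟨hsum, hsum.hasStrangeAsymptotics
      (hasExpansion_H9Fun (one_add_pow_ne_zero_of_odd hodd hζ.pow_eq_one))⟩
  · obtain ⟨h, rfl⟩ := heven.two_dvd
    have hh : 0 < h := by omega
    refine ⟨exists_isEntireContinuation_coeffL2 hh (pow_half_eq_neg_one hh hζ),
      fun L hL => ?_⟩
    have hsum := isFormalSum_H10Ser hh hζ hL
    exact ⟨hsum, hsum.hasStrangeAsymptotics
      (hasExpansion_H10Fun (one_sub_pow_odd_ne_zero hζ))⟩
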